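/- Let $\mathbb K$ be a field of characteristic zero, and consider linear operators on $\mathbb K[x]$; write $\mathbf x$ for multiplication by $x$ and $D$ for the derivative. A delta operator is a linear operator $Q$ that commutes with all shifts $p(x)\mapsto p(x+a)$, $a\in\mathbb K$, and satisfies $Qx=c$ for a constant $c\neq0$; it is unitary if $c=1$. An invertible operator $\phi$ is the umbral operator for the delta operator $Q$ if $\phi 1=1$, $(\phi x^n)(0)=0$ for $n>0$, and $Q\phi x^n=n\,\phi x^{n-1}$ for all $n\ge 0$; it is unitary if $[x^n]\phi x^n=1$ for all $n$. The indicator of $Q$ is the power series $\tilde Q(t)=\sum_{k\ge0}\frac{(Qx^k)(0)}{k!}t^k$. Fractional iterates of a power series $f$ are power series $(f^s)_{s\in\mathbb K}$ without constant term with $f^1=f$ and $f^r\circ f^s=f^{r+s}$ for all $r,s\in\mathbb K$; when they depend regularly on $s$, the iterative logarithm is $\operatorname{itlog}(f)=\frac{d}{ds}f^s\big|_{s=0}$, taken coefficientwise. Let $\phi$ be the umbral operator for a delta operator $Q$. Then $Q=\tilde Q(D)$, and $\phi$ is unitary if and only if $Q$ is. (1) Suppose $\phi$ is unitary. Then $\tilde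 Q$ has exactly one family of fractional iterates $\tilde Q^s$ whose coefficients are polynomials in $s$; let $\operatorname{itlog}(\tilde Q)$ be defined by it and put $Q_*=\operatorname{itlog}(\tilde Q)(D)$. The operator $\mathbf xQ_*$ is locally nilpotent (each polynomial is annihilated by some power of it), and $$\phi=e^{-\mathbf xQ_*}.$$ Moreover, for $s\in\mathbb K$ put $\phi^s=e^{-s\,\mathbf xQ_*}$. Then $\phi^{r+s}=\phi^r\phi^s$ for all $r,s\in\mathbb K$; for $s\in\mathbb Z$ this is the usual power of $\phi$; and for every $s\in\mathbb K$ the operator $\phi^s$ is again a unitary umbral operator, namely the one for the delta operator $\tilde Q^s(D)$. (2) Suppose $\mathbb K$ is $\mathbb R$ or $\mathbb C$, with $Q$ not necessarily unitary. For any family $(\tilde Q^s)_{s\in\mathbb K}$ of fractional iterates of $\tilde Q$ whose coefficients are differentiable in $s$ at $s=0$, with $Q_*=\big(\frac{d}{ds}\tilde Q^s\big|_{s=0}\big)(D)$, one has $\phi=e^{-\mathbf xQ_*}$, where the exponential series, applied to any polynomial, converges coefficientwise. -/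

import Mathlib

open scoped Polynomial PowerSeries

namespace Umbral

noncomputable section

section Field

variable {K : Type*} [Field K]

/-- Linear operators on univariate polynomials; the product is composition. -/
abbrev Op (K : Type*) [Field K] := Module.End K K[X]

/-- Multiplication by the variable. -/
def mulX : Op K := LinearMap.mulLeft K (Polynomial.X : K[X])

/-- The derivative. -/
def D : Op K := Polynomial.derivative

/-- `g(D) = ∑ k, g_k D ^ k`. On `x ^ n` the terms with `k > n` vanish. -/
def seriesOp (g : K⟦X⟧) : Op K :=
  (Polynomial.basisMonomials K).constr K fun n =>
    ∑ k ∈ Finset.range (n + 1), PowerSeries.coeff k g • (D ^ k) (Polynomial.X ^ n : K[X])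

/-- Shift-invariance; `Polynomial.taylor a` is the shift `p(x) ↦ p(x + a)`. -/
def IsShiftInvariant (U : Op K) : Prop :=
  ∀ a : K, Commute U (Polynomial.taylor a : Op K)

/-- Delta operators: shift-invariant, with `Q x` a nonzero constant. -/
def IsDelta (Q : Op K) : Prop :=
  IsShiftInvariant Q ∧ ∃ c : K, c ≠ 0 ∧ Q Polynomial.X = Polynomial.C c

/-- Unitary delta operators: `Q x = 1`. -/
def IsUnitaryDelta (Q : Op K) : Prop :=
  IsShiftInvariant Q ∧ Q Polynomial.X = 1

/-- `φ` is the umbral operator for (is basic for) the delta operator `Q`. -/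
structure IsUmbralFor (φ Q : Op K) : Prop where
  delta : IsDelta Q
  invertible : IsUnit φ
  sheffer : ∀ n : ℕ, Q (φ (Polynomial.X ^ n)) = (n : K) • φ (Polynomial.X ^ (n - 1))
  zeroth : φ 1 = 1
  eval_zero : ∀ n : ℕ, 0 < n → (φ (Polynomial.X ^ n)).eval 0 = 0

/-- `φ` is unitary: `φ x ^ n` has `x ^ n`-coefficient `1`. -/
def IsUnitaryOp (φ : Op K) : Prop :=
  ∀ n : ℕ, (φ (Polynomial.X ^ n)).coeff n = 1

/-- The indicator of a shift-invariant operator `T`, the power series `∑ k, (T x ^ k)(0) / k! t ^ k`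
for which `seriesOp (indicator T) = T`. -/
def indicator (T : Op K) : K⟦X⟧ :=
  PowerSeries.mk fun k => (T (Polynomial.X ^ k)).eval 0 / (k.factorial : K)

/-- `F` is a one-parameter group of compositional iterates of `f`: `f¹ = f` and
`f^r ∘ f^s = f^(r+s)`, where `PowerSeries.subst a g` is `g ∘ a`. -/
structure IsIteration (f : K⟦X⟧) (F : K → K⟦X⟧) : Prop where
  constantCoeff : ∀ s, PowerSeries.constantCoeff (F s) = 0
  one : F 1 = f
  comp : ∀ r s, PowerSeries.subst (F s) (F r) = F (r + s)

/-- Evaluate at `s` a power series whose coefficients are polynomials in a parameter. -/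
def atParam (F : PowerSeries K[X]) (s : K) : K⟦X⟧ :=
  PowerSeries.map (Polynomial.evalRingHom s) F

/-- `F` gives fractional iterates of `f` whose coefficients are polynomials in the exponent. -/
def IsFractionalIteration (f : K⟦X⟧) (F : PowerSeries K[X]) : Prop :=
  IsIteration f (atParam F)

open Classical in
/-- The fractional iteration of `f` (zero if there is none). -/
def fractionalIteration (f : K⟦X⟧) : PowerSeries K[X] :=
  if h : ∃ F, IsFractionalIteration f F then h.choose else 0

/-- The fractional iterate `f^s`. -/
def iter (f : K⟦X⟧) (s : K) : K⟦X⟧ := atParam (fractionalIteration f) s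

/-- The iterative logarithm: the coefficientwise derivative of `f^s` with respect to `s`
at `s = 0`. -/
def itlog (f : K⟦X⟧) : K⟦X⟧ :=
  PowerSeries.mk fun n =>
    (Polynomial.derivative (PowerSeries.coeff n (fractionalIteration f))).eval 0

/-- `Q_* = itlog(Q̃)(D)`. -/
def star (Q : Op K) : Op K := seriesOp (itlog (indicator Q))

/-- Every polynomial is annihilated by some power of `U`, so that the series `∑ k, U ^ k / k!`
is a finite sum on each polynomial. -/
def IsLocallyNilpotent (U : Op K) : Prop :=
  ∀ p : K[X], ∃ k : ℕ, (U ^ k) p = 0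

/-- The exponential `∑ k, U ^ k / k!` of a locally nilpotent operator. -/
def opExp (U : Op K) : Op K :=
  (Polynomial.basisMonomials K).constr K fun n =>
    ∑ᶠ k : ℕ, (k.factorial : K)⁻¹ • (U ^ k) (Polynomial.X ^ n : K[X])

/-- The fractional power `φ^s = e^(-s x Q_*)` of the unitary umbral operator `φ` for `Q`. -/
def fracPow (Q : Op K) (s : K) : Op K := opExp (-(s • (mulX * star Q)))

end Field

section RCLike

variable {𝕜 : Type*} [RCLike 𝕜]

/-- `g` is the coefficientwise derivative at `s = 0` of the family `F` of iterates, i.e. the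
iterative logarithm belonging to `F`. -/
def IsItlog (F : 𝕜 → 𝕜⟦X⟧) (g : 𝕜⟦X⟧) : Prop :=
  ∀ n, HasDerivAt (fun s => PowerSeries.coeff n (F s)) (PowerSeries.coeff n g) 0

/-- `V = ∑ k, U ^ k / k!`, the series converging coefficientwise on every polynomial. -/
def HasOpExp (U V : Op 𝕜) : Prop :=
  ∀ (p : 𝕜[X]) (n : ℕ),
    HasSum (fun k : ℕ => ((k.factorial : 𝕜)⁻¹ • (U ^ k) p).coeff n) ((V p).coeff n)

end RCLike

end

end Umbral

/-!
The pairing `⟨p, h⟩ = (h(D) p)(0)` of polynomials with power series identifies operators on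
polynomials with the transposes of operators on power series. It turns `g(D)` into multiplication
by `g` and `𝐱` into `d/dt`, hence `𝐱 g(D)` into the vector field `g d/dt`. The umbral operator `φ`
for `Q` is characterized by `⟨φ p, h ∘ Q̃⟩ = ⟨p, h⟩`: its transpose is `h ↦ h ∘ Q̃⁻¹`. So
`φ = e^(-𝐱 Q_*)` is the transpose of the Lie series `h ∘ f^s = e^(s (itlog f) d/dt) h`, taken at
`f = Q̃` and `s = -1`. Differentiating the group law `h ∘ f^(r+s) = (h ∘ f^s) ∘ f^r` in `r` at
`r = 0` gives `d/ds (h ∘ f^s) = (itlog f) d/dt (h ∘ f^s)`, whose solution is that series. If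
`f = t + O(t²)`, then `itlog f = O(t²)` and each coefficient is a finite sum. In general `g d/dt`
still does not lower the order, and so acts on truncated power series, where the equation is a
linear system with constant coefficients.
-/

namespace Umbral

noncomputable section

open PowerSeries (X coeff constantCoeff subst HasSubst)

section PowerSeries

variable {R : Type*} [CommRing R]

/-- `A` raises the order of every power series by at least `d`. -/
def RaisesOrder (A : Module.End R R⟦X⟧) (d : ℕ) : Prop :=
  ∀ (m : ℕ) (h : R⟦X⟧), X ^ m ∣ h → X ^ (m + d) ∣ A h

theorem RaisesOrder.pow {A : Module.End R R⟦X⟧} {d : ℕ} (hA : RaisesOrder A d) (k : ℕ) :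
    RaisesOrder (A ^ k) (k * d) := by
  induction k with
  | zero => intro m h hh; simpa using hh
  | succ k ih =>
    intro m h hh
    rw [pow_succ', Module.End.mul_apply, add_one_mul, ← add_assoc]
    exact hA _ _ (ih _ _ hh)

theorem RaisesOrder.coeff_pow_apply_eq_zero {A : Module.End R R⟦X⟧} (hA : RaisesOrder A 1)
    (h : R⟦X⟧) {k n : ℕ} (hn : n < k) : coeff n ((A ^ k) h) = 0 :=
  PowerSeries.X_pow_dvd_iff.1 (hA.pow k 0 h (by simp)) n (by simpa using hn)

/-- The truncation of a power series to its first `N` coefficients. -/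
def coeffs (R : Type*) [CommRing R] (N : ℕ) : R⟦X⟧ →ₗ[R] Fin N → R :=
  LinearMap.pi fun i => coeff i

theorem coeffs_apply (N : ℕ) (h : R⟦X⟧) (i : Fin N) : coeffs R N h i = coeff i h := rfl

theorem coeffs_eq_zero_iff {N : ℕ} {h : R⟦X⟧} : coeffs R N h = 0 ↔ X ^ N ∣ h := by
  rw [PowerSeries.X_pow_dvd_iff, funext_iff, Fin.forall_iff]
  rfl

theorem RaisesOrder.exists_truncation {A : Module.End R R⟦X⟧} (hA : RaisesOrder A 0) (N : ℕ) :
    ∃ M : Module.End R (Fin N → R), ∀ h, M (coeffs R N h) = coeffs R N (A h) := by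
  let lift : (Fin N → R) →ₗ[R] R⟦X⟧ := Fintype.linearCombination R fun i : Fin N => X ^ (i : ℕ)
  refine ⟨coeffs R N ∘ₗ A ∘ₗ lift, fun h => ?_⟩
  have hlift : coeffs R N (lift (coeffs R N h) - h) = 0 := by
    ext i
    simp [lift, Fintype.linearCombination_apply, coeffs_apply, PowerSeries.coeff_X_pow, Fin.val_inj]
  have := coeffs_eq_zero_iff.2 (hA N _ (coeffs_eq_zero_iff.1 hlift))
  rwa [map_sub, map_sub, sub_eq_zero] at this

theorem coeff_mul_subst_eq_sum (g : R⟦X⟧) {f : R⟦X⟧} (hf : constantCoeff f = 0) (h : R⟦X⟧)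
    {n N : ℕ} (hn : n < N) :
    coeff n (g * subst f h) = ∑ k ∈ Finset.range N, coeff k h * coeff n (g * f ^ k) := by
  have hs := HasSubst.of_constantCoeff_zero' hf
  have hzero : ∀ i j, i < j → coeff i (f ^ j) = 0 := fun i j hij =>
    PowerSeries.X_pow_dvd_iff.1 (pow_dvd_pow_of_dvd (PowerSeries.X_dvd_iff.2 hf) j) i hij
  have hcoeff : ∀ i < N, coeff i (subst f h) =
      ∑ k ∈ Finset.range N, coeff k h * coeff i (f ^ k) := fun i hi => by
    rw [PowerSeries.coeff_subst' hs]
    refine finsum_eq_sum_of_support_subset _ fun k hk => ?_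
    rw [Finset.coe_range, Set.mem_Iio]
    by_contra! hNk
    exact hk (by simp only [smul_eq_mul, hzero i k (by omega), mul_zero])
  simp only [PowerSeries.coeff_mul, Finset.mul_sum]
  rw [Finset.sum_comm]
  refine Finset.sum_congr rfl fun i hi => ?_
  rw [hcoeff _ ((Finset.HasAntidiagonal.antidiagonal.snd_le hi).trans_lt hn), Finset.mul_sum]
  exact Finset.sum_congr rfl fun k _ => mul_left_comm _ _ _

theorem coeff_subst_eq_sum {f : R⟦X⟧} (hf : constantCoeff f = 0) (h : R⟦X⟧) {n N : ℕ}
    (hn : n < N) : coeff n (subst f h) = ∑ k ∈ Finset.range N, coeff k h * coeff n (f ^ k) := by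
  simpa only [one_mul] using coeff_mul_subst_eq_sum 1 hf h hn

theorem constantCoeff_subst_of_constantCoeff_eq_zero {f : R⟦X⟧} (hf : constantCoeff f = 0)
    (h : R⟦X⟧) : constantCoeff (subst f h) = constantCoeff h := by
  simpa using coeff_subst_eq_sum hf h zero_lt_one

theorem coeff_one_subst {f : R⟦X⟧} (hf : constantCoeff f = 0) (h : R⟦X⟧) :
    coeff 1 (subst f h) = coeff 1 h * coeff 1 f := by
  rw [coeff_subst_eq_sum hf h (Nat.lt_succ_self 1), Finset.sum_range_succ, Finset.sum_range_one]
  simp [PowerSeries.coeff_one]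

theorem subst_X_pow {f : R⟦X⟧} (hf : constantCoeff f = 0) (k : ℕ) :
    subst f (X ^ k : R⟦X⟧) = f ^ k := by
  have hs := HasSubst.of_constantCoeff_zero' hf
  rw [PowerSeries.subst_pow hs, PowerSeries.subst_X hs]

theorem coeff_self_pow {f : R⟦X⟧} (hf : constantCoeff f = 0) (n : ℕ) :
    coeff n (f ^ n) = coeff 1 f ^ n := by
  obtain ⟨w, rfl⟩ := PowerSeries.X_dvd_iff.2 hf
  have hw := PowerSeries.coeff_succ_X_mul 0 w
  have hwn := PowerSeries.coeff_X_pow_mul (w ^ n) n 0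
  rw [zero_add] at hw hwn
  rw [mul_pow, hwn, hw, PowerSeries.coeff_zero_eq_constantCoeff, map_pow]

theorem subst_surjective {f : R⟦X⟧} (hf : constantCoeff f = 0) (hu : IsUnit (coeff 1 f)) :
    Function.Surjective (subst f : R⟦X⟧ → R⟦X⟧) := fun h =>
  ⟨subst (f.substInvOfIsUnit hu) h, by
    rw [PowerSeries.subst_comp_subst_apply
      (HasSubst.of_constantCoeff_zero' (PowerSeries.constantCoeff_substInvOfIsUnit f hu))
      (HasSubst.of_constantCoeff_zero' hf), PowerSeries.subst_substInvOfIsUnit_left f hf hu,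
      PowerSeries.X_subst]⟩

/-- The vector field `g d/dt`. -/
def mulDeriv (g : R⟦X⟧) : Module.End R R⟦X⟧ :=
  LinearMap.mulLeft R g ∘ₗ (PowerSeries.derivative R : R⟦X⟧ →ₗ[R] R⟦X⟧)

theorem mulDeriv_apply (g h : R⟦X⟧) : mulDeriv g h = g * PowerSeries.derivative R h := rfl

theorem raisesOrder_mulDeriv {g : R⟦X⟧} {d : ℕ} (hg : X ^ (d + 1) ∣ g) :
    RaisesOrder (mulDeriv g) d := by
  rintro m h hh
  rw [mulDeriv_apply]
  cases m with
  | zero =>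
    rw [zero_add]
    exact ((pow_dvd_pow _ d.le_succ).trans hg).mul_right _
  | succ m =>
    rw [show m + 1 + d = (d + 1) + m by ring, pow_add]
    refine mul_dvd_mul hg ?_
    rw [PowerSeries.X_pow_dvd_iff] at hh ⊢
    intro k hk
    rw [PowerSeries.coeff_derivative, hh _ (by omega), zero_mul]

/-- `f = t + O(t ^ 2)`: the power series for which fractional iterates are constructed. -/
structure IsTangentToId (f : R⟦X⟧) : Prop where
  constantCoeff : constantCoeff f = 0
  coeff_one : coeff 1 f = 1

theorem IsTangentToId.hasSubst {f : R⟦X⟧} (hf : IsTangentToId f) : HasSubst f :=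
  HasSubst.of_constantCoeff_zero' hf.constantCoeff

theorem IsTangentToId.raisesOrder_subst_sub_one {f : R⟦X⟧} (hf : IsTangentToId f) :
    RaisesOrder ((PowerSeries.substAlgHom (R := R) hf.hasSubst).toLinearMap - 1) 1 := by
  rintro m _ ⟨q, rfl⟩
  obtain ⟨w, hw⟩ := PowerSeries.X_dvd_iff.2 hf.constantCoeff
  have hw1 : X ∣ w ^ m - 1 := by
    refine dvd_trans ?_ (sub_one_dvd_pow_sub_one w m)
    rw [PowerSeries.X_dvd_iff, map_sub, map_one, sub_eq_zero, ← hf.coeff_one, hw]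
    simp
  have hq : X ∣ subst f q - q := by
    rw [PowerSeries.X_dvd_iff, map_sub,
      constantCoeff_subst_of_constantCoeff_eq_zero hf.constantCoeff, sub_self]
  have hfm : f ^ m = X ^ m * w ^ m := by rw [hw, mul_pow]
  have hsplit : X ^ m * w ^ m * subst f q - X ^ m * q =
      X ^ m * ((w ^ m - 1) * subst f q + (subst f q - q)) := by ring
  rw [LinearMap.sub_apply, AlgHom.toLinearMap_apply, PowerSeries.coe_substAlgHom,
    Module.End.one_apply, PowerSeries.subst_mul hf.hasSubst, subst_X_pow hf.constantCoeff, hfm,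
    hsplit, pow_succ]
  exact mul_dvd_mul_left _ (dvd_add (hw1.mul_right _) hq)

end PowerSeries

section PointDerivation

variable {R S : Type*} [CommRing R]

/-- `T f a` stands for: `f` has derivative `a` at `s₀`, with the rules for constants, sums and
products. A relation, since not every function need be differentiable; it treats polynomial and
analytic dependence on a parameter alike. -/
structure IsPointDerivation (T : (S → R) → R → Prop) (s₀ : S) : Prop where
  const : ∀ a, T (fun _ => a) 0
  add : ∀ {f g a b}, T f a → T g b → T (fun s => f s + g s) (a + b)
  mul : ∀ {f g a b}, T f a → T g b → T (fun s => f s * g s) (f s₀ * b + a * g s₀)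

namespace IsPointDerivation

variable {T : (S → R) → R → Prop} {s₀ : S}

theorem sum (hT : IsPointDerivation T s₀) {ι : Type*} (u : Finset ι) {f : ι → S → R} {a : ι → R}
    (hf : ∀ i ∈ u, T (f i) (a i)) : T (fun s => ∑ i ∈ u, f i s) (∑ i ∈ u, a i) := by
  classical
  induction u using Finset.induction_on with
  | empty => simpa using hT.const 0
  | insert i u hi ih =>
    simp only [Finset.sum_insert hi]
    exact hT.add (hf i (Finset.mem_insert_self i u))
      (ih fun j hj => hf j (Finset.mem_insert_of_mem hj))

theorem const_mul (hT : IsPointDerivation T s₀) (c : R) {f : S → R} {a : R} (hf : T f a) :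
    T (fun s => c * f s) (c * a) := by
  simpa only [zero_mul, add_zero] using hT.mul (hT.const c) hf

variable {F G : S → R⟦X⟧} {f g : R⟦X⟧}

theorem coeff_mul (hT : IsPointDerivation T s₀) (hF : ∀ n, T (fun s => coeff n (F s)) (coeff n f))
    (hG : ∀ n, T (fun s => coeff n (G s)) (coeff n g)) (n : ℕ) :
    T (fun s => coeff n (F s * G s)) (coeff n (F s₀ * g + f * G s₀)) := by
  simpa only [map_add, PowerSeries.coeff_mul, Finset.sum_add_distrib] using
    hT.sum (Finset.HasAntidiagonal.antidiagonal n) fun i _ => hT.mul (hF i.1) (hG i.2)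

theorem coeff_pow_succ (hT : IsPointDerivation T s₀)
    (hF : ∀ n, T (fun s => coeff n (F s)) (coeff n f)) (k n : ℕ) :
    T (fun s => coeff n (F s ^ (k + 1))) (coeff n ((k + 1) • (f * F s₀ ^ k))) := by
  induction k generalizing n with
  | zero => simpa using hF n
  | succ k ih =>
    have hsucc : F s₀ ^ (k + 1) * f + (k + 1) • (f * F s₀ ^ k) * F s₀ =
        (k + 1 + 1) • (f * F s₀ ^ (k + 1)) := by simp only [nsmul_eq_mul]; push_cast; ring
    simpa only [← pow_succ, hsucc] using hT.coeff_mul ih hF n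

theorem coeff_subst (hT : IsPointDerivation T s₀)
    (hF₀ : ∀ s, constantCoeff (F s) = 0) (hF : ∀ n, T (fun s => coeff n (F s)) (coeff n f))
    (h : R⟦X⟧) (n : ℕ) :
    T (fun s => coeff n (subst (F s) h))
      (coeff n (f * subst (F s₀) (PowerSeries.derivative R h))) := by
  have hsum : ∀ s, coeff n (subst (F s) h) = (∑ k ∈ Finset.range (n + 1),
      coeff (k + 1) h * coeff n (F s ^ (k + 1))) + coeff 0 h * coeff n (1 : R⟦X⟧) := fun s => by
    rw [coeff_subst_eq_sum (hF₀ s) h (show n < n + 2 by omega), Finset.sum_range_succ', pow_zero]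
  have hderiv : coeff n (f * subst (F s₀) (PowerSeries.derivative R h)) =
      (∑ k ∈ Finset.range (n + 1),
        coeff (k + 1) h * coeff n ((k + 1) • (f * F s₀ ^ k))) + 0 := by
    rw [coeff_mul_subst_eq_sum f (hF₀ s₀) _ n.lt_succ_self, add_zero]
    refine Finset.sum_congr rfl fun k _ => ?_
    rw [PowerSeries.coeff_derivative, map_nsmul, nsmul_eq_mul, mul_assoc, Nat.cast_succ]
  rw [hderiv]
  simp only [hsum]
  exact hT.add (hT.sum _ fun k _ => hT.const_mul _ (hT.coeff_pow_succ hF k n)) (hT.const _)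

end IsPointDerivation

theorem isPointDerivation_polynomial (s₀ : R) :
    IsPointDerivation (fun (f : R → R) a =>
      ∃ P : R[X], (∀ s, f s = P.eval s) ∧ a = (Polynomial.derivative P).eval s₀) s₀ where
  const a := ⟨Polynomial.C a, by simp, by simp⟩
  add := by
    rintro f g _ _ ⟨P, hP, rfl⟩ ⟨Q, hQ, rfl⟩
    exact ⟨P + Q, fun s => by simp only [hP, hQ, Polynomial.eval_add],
      by rw [Polynomial.derivative_add, Polynomial.eval_add]⟩
  mul := by
    rintro f g _ _ ⟨P, hP, rfl⟩ ⟨Q, hQ, rfl⟩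
    refine ⟨P * Q, fun s => by simp only [hP, hQ, Polynomial.eval_mul], ?_⟩
    rw [Polynomial.derivative_mul, Polynomial.eval_add, Polynomial.eval_mul, Polynomial.eval_mul,
      hP, hQ, add_comm]

theorem isPointDerivation_hasDerivAt {𝕜 : Type*} [NontriviallyNormedField 𝕜] (s₀ : 𝕜) :
    IsPointDerivation (fun (f : 𝕜 → 𝕜) a => HasDerivAt f a s₀) s₀ where
  const := hasDerivAt_const s₀
  add hf hg := hf.add hg
  mul hf hg := by
    have := hf.mul hg
    rwa [add_comm] at this

end PointDerivation

section Iteration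

variable {K : Type*} [Field K] {f : K⟦X⟧}

namespace IsIteration

variable {F : K → K⟦X⟧}

theorem hasSubst (hF : IsIteration f F) (s : K) : HasSubst (F s) :=
  HasSubst.of_constantCoeff_zero' (hF.constantCoeff s)

theorem subst_subst_apply (hF : IsIteration f F) (r s : K) (h : K⟦X⟧) :
    subst (F s) (subst (F r) h) = subst (F (r + s)) h := by
  rw [PowerSeries.subst_comp_subst_apply (hF.hasSubst r) (hF.hasSubst s), hF.comp]

theorem zero (hF : IsIteration f F) (hf : coeff 1 f ≠ 0) : F 0 = X := by
  have hf₀ : PowerSeries.constantCoeff f = 0 := hF.one ▸ hF.constantCoeff 1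
  obtain ⟨h, hh⟩ := subst_surjective hf₀ hf.isUnit X
  have := hF.subst_subst_apply 1 0 h
  rwa [add_zero, hF.one, hh, PowerSeries.subst_X (hF.hasSubst 0)] at this

theorem subst_neg_subst (hF : IsIteration f F) (hf : coeff 1 f ≠ 0) (s : K) (h : K⟦X⟧) :
    subst (F (-s)) (subst (F s) h) = h := by
  rw [hF.subst_subst_apply, add_neg_cancel, hF.zero hf, PowerSeries.X_subst]

end IsIteration

theorem coeff_atParam (F : PowerSeries K[X]) (s : K) (n : ℕ) :
    coeff n (atParam F s) = (coeff n F).eval s := by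
  rw [atParam, PowerSeries.coeff_map, Polynomial.coe_evalRingHom]

theorem atParam_map_C (h : K⟦X⟧) (s : K) : atParam (PowerSeries.map Polynomial.C h) s = h := by
  ext n
  rw [coeff_atParam, PowerSeries.coeff_map, Polynomial.eval_C]

theorem atParam_subst {G : PowerSeries K[X]} (hG : constantCoeff G = 0) (F : PowerSeries K[X])
    (s : K) : atParam (subst G F) s = subst (atParam G s) (atParam F s) :=
  PowerSeries.map_subst (HasSubst.of_constantCoeff_zero' hG) F

theorem atParam_map_taylor (F : PowerSeries K[X]) (r s : K) :
    atParam (PowerSeries.map (Polynomial.taylorAlgHom r : K[X] →+* K[X]) F) s =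
      atParam F (s + r) := by
  ext n
  simp [coeff_atParam, Polynomial.taylor_eval]

theorem polynomial_eq_of_eval_natCast [CharZero K] {P Q : K[X]}
    (H : ∀ m : ℕ, P.eval (m : K) = Q.eval (m : K)) : P = Q :=
  Polynomial.eq_of_infinite_eval_eq P Q
    (Set.infinite_of_injective_forall_mem (Nat.cast_injective (R := K)) H)

theorem eq_of_atParam_natCast [CharZero K] {F G : PowerSeries K[X]}
    (H : ∀ m : ℕ, atParam F (m : K) = atParam G (m : K)) : F = G := by
  ext1 n
  exact polynomial_eq_of_eval_natCast fun m => by rw [← coeff_atParam, ← coeff_atParam, H]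

/-- The `m`-fold composite `f ∘ ⋯ ∘ f`. -/
def compPow (f : K⟦X⟧) (m : ℕ) : K⟦X⟧ := (subst f)^[m] X

theorem compPow_succ (m : ℕ) : compPow f (m + 1) = subst f (compPow f m) :=
  Function.iterate_succ_apply' _ _ _

theorem constantCoeff_compPow (hf : constantCoeff f = 0) (m : ℕ) :
    constantCoeff (compPow f m) = 0 := by
  induction m with
  | zero => simp [compPow]
  | succ m ih => rw [compPow_succ, constantCoeff_subst_of_constantCoeff_eq_zero hf, ih]

theorem subst_compPow_compPow (hf : constantCoeff f = 0) (m k : ℕ) :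
    subst (compPow f k) (compPow f m) = compPow f (m + k) := by
  induction k with
  | zero => exact PowerSeries.X_subst _
  | succ k ih =>
    rw [compPow_succ, ← add_assoc, compPow_succ, ← ih, PowerSeries.subst_comp_subst_apply
      (HasSubst.of_constantCoeff_zero' (constantCoeff_compPow hf k))
      (HasSubst.of_constantCoeff_zero' hf)]

theorem IsIteration.natCast {F : K → K⟦X⟧} (hF : IsIteration f F) (hf : coeff 1 f ≠ 0) (m : ℕ) :
    F m = compPow f m := by
  induction m with
  | zero => rw [Nat.cast_zero, hF.zero hf]; rfl
  | succ m ih => rw [Nat.cast_succ, ← hF.comp, hF.one, ih, compPow_succ]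

theorem isFractionalIteration_of_natCast [CharZero K] (hf : constantCoeff f = 0)
    {F : PowerSeries K[X]} (hF : ∀ m : ℕ, atParam F (m : K) = compPow f m) :
    IsFractionalIteration f F := by
  have hc : constantCoeff F = 0 := polynomial_eq_of_eval_natCast fun m => by
    rw [← PowerSeries.coeff_zero_eq_constantCoeff_apply, ← coeff_atParam, hF,
      PowerSeries.coeff_zero_eq_constantCoeff_apply, constantCoeff_compPow hf, Polynomial.eval_zero]
  have hcs : ∀ s, constantCoeff (atParam F s) = 0 := fun s => by
    rw [← PowerSeries.coeff_zero_eq_constantCoeff_apply, coeff_atParam,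
      PowerSeries.coeff_zero_eq_constantCoeff_apply, hc, Polynomial.eval_zero]
  have hcC : ∀ s, constantCoeff (PowerSeries.map Polynomial.C (atParam F s)) = 0 := fun s => by
    rw [← PowerSeries.coeff_zero_eq_constantCoeff_apply, PowerSeries.coeff_map,
      PowerSeries.coeff_zero_eq_constantCoeff_apply, hcs, map_zero]
  -- The group law is a polynomial identity in `r` and `s`; it holds on `ℕ × ℕ`.
  have hcomp_natCast : ∀ (r : K) (k : ℕ),
      subst (atParam F k) (atParam F r) = atParam F (r + k) := fun r k => by
    have hpoly : subst (PowerSeries.map Polynomial.C (atParam F k)) F =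
        PowerSeries.map (Polynomial.taylorAlgHom (k : K) : K[X] →+* K[X]) F :=
      eq_of_atParam_natCast fun m => by
        rw [atParam_subst (hcC _), atParam_map_C, atParam_map_taylor, ← Nat.cast_add, hF, hF, hF,
          subst_compPow_compPow hf]
    rw [← atParam_map_taylor, ← hpoly, atParam_subst (hcC _), atParam_map_C]
  refine ⟨hcs, ?_, fun r s => ?_⟩
  · rw [← Nat.cast_one, hF, compPow_succ]
    exact PowerSeries.subst_X (HasSubst.of_constantCoeff_zero' hf)
  · have hpoly : subst F (PowerSeries.map Polynomial.C (atParam F r)) =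
        PowerSeries.map (Polynomial.taylorAlgHom r : K[X] →+* K[X]) F :=
      eq_of_atParam_natCast fun k => by
        rw [atParam_subst hc, atParam_map_C, atParam_map_taylor, hcomp_natCast, add_comm]
    rw [add_comm, ← atParam_map_taylor, ← hpoly, atParam_subst hc, atParam_map_C]

theorem exists_polynomial_eval_natCast_eq_choose [CharZero K] (j : ℕ) :
    ∃ P : K[X], ∀ m : ℕ, P.eval (m : K) = m.choose j := by
  refine ⟨Polynomial.C (j.factorial : K)⁻¹ * descPochhammer K j, fun m => ?_⟩
  rw [Polynomial.eval_mul, Polynomial.eval_C, descPochhammer_eval_eq_descFactorial,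
    Nat.descFactorial_eq_factorial_mul_choose, Nat.cast_mul,
    inv_mul_cancel_left₀ (Nat.cast_ne_zero.2 j.factorial_ne_zero)]

theorem coeff_pow_apply_eq_sum_choose {R : Type*} [CommRing R] {A : Module.End R R⟦X⟧}
    (hA : RaisesOrder (A - 1) 1) (h : R⟦X⟧) (n m : ℕ) :
    coeff n ((A ^ m) h) =
      ∑ j ∈ Finset.range (n + 1), (m.choose j : R) * coeff n (((A - 1) ^ j) h) := by
  have hpow : A ^ m = ∑ j ∈ Finset.range (m + 1), m.choose j • (A - 1) ^ j := by
    conv_lhs => rw [← sub_add_cancel A 1, (Commute.one_right (A - 1)).add_pow]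
    simp only [one_pow, mul_one, nsmul_eq_mul']
  have hmax : coeff n ((A ^ m) h) =
      ∑ j ∈ Finset.range (n + m + 1), (m.choose j : R) * coeff n (((A - 1) ^ j) h) := by
    simp only [hpow, LinearMap.sum_apply, LinearMap.smul_apply, map_sum, map_nsmul]
    simp only [nsmul_eq_mul]
    refine Finset.sum_subset (Finset.range_subset_range.2 (by omega)) fun j _ hj => ?_
    rw [Nat.choose_eq_zero_of_lt (by rw [Finset.mem_range] at hj; omega), Nat.cast_zero, zero_mul]
  rw [hmax]
  refine (Finset.sum_subset (Finset.range_subset_range.2 (by omega)) fun j _ hj => ?_).symm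
  rw [hA.coeff_pow_apply_eq_zero _ (by rw [Finset.mem_range] at hj; omega), mul_zero]

theorem IsTangentToId.coeff_one_ne_zero (hf : IsTangentToId f) : coeff 1 f ≠ 0 := by
  rw [hf.coeff_one]
  exact one_ne_zero

theorem IsTangentToId.exists_atParam_natCast [CharZero K] (hf : IsTangentToId f) :
    ∃ F : PowerSeries K[X], ∀ m : ℕ, atParam F (m : K) = compPow f m := by
  choose P hP using exists_polynomial_eval_natCast_eq_choose (K := K)
  let A : Module.End K K⟦X⟧ := (PowerSeries.substAlgHom (R := K) hf.hasSubst).toLinearMap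
  refine ⟨PowerSeries.mk fun n =>
    ∑ j ∈ Finset.range (n + 1), P j * Polynomial.C (coeff n (((A - 1) ^ j) X)), fun m => ?_⟩
  ext n
  have hA : ⇑A = subst f := PowerSeries.coe_substAlgHom hf.hasSubst
  rw [compPow, ← hA, ← Module.End.pow_apply,
    coeff_pow_apply_eq_sum_choose hf.raisesOrder_subst_sub_one]
  simp [A, coeff_atParam, Polynomial.eval_finsetSum, hP]

theorem IsTangentToId.existsUnique_isFractionalIteration [CharZero K] (hf : IsTangentToId f) :
    ∃! F, IsFractionalIteration f F := by
  obtain ⟨F, hF⟩ := hf.exists_atParam_natCast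
  refine ⟨F, isFractionalIteration_of_natCast hf.constantCoeff hF, fun G hG => ?_⟩
  exact eq_of_atParam_natCast fun m => by
    rw [hF, IsIteration.natCast hG hf.coeff_one_ne_zero]

theorem IsTangentToId.isFractionalIteration [CharZero K] (hf : IsTangentToId f) :
    IsFractionalIteration f (fractionalIteration f) := by
  have h := hf.existsUnique_isFractionalIteration.exists
  rw [fractionalIteration, dif_pos h]
  exact h.choose_spec

theorem IsTangentToId.isIteration_iter [CharZero K] (hf : IsTangentToId f) :
    IsIteration f (iter f) :=
  hf.isFractionalIteration

theorem IsFractionalIteration.constantCoeff_eq_zero [CharZero K] {F : PowerSeries K[X]}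
    (hF : IsFractionalIteration f F) : constantCoeff F = 0 :=
  Polynomial.funext fun s => by
    rw [← PowerSeries.coeff_zero_eq_constantCoeff_apply, ← coeff_atParam,
      PowerSeries.coeff_zero_eq_constantCoeff_apply, hF.constantCoeff, Polynomial.eval_zero]

theorem IsFractionalIteration.coeff_one [CharZero K] {F : PowerSeries K[X]}
    (hF : IsFractionalIteration f F) (hf : IsTangentToId f) : coeff 1 F = 1 := by
  refine polynomial_eq_of_eval_natCast fun m => ?_
  rw [← coeff_atParam, Polynomial.eval_one]
  induction m with
  | zero =>
    rw [Nat.cast_zero, IsIteration.zero hF hf.coeff_one_ne_zero, PowerSeries.coeff_one_X]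
  | succ m ih =>
    rw [Nat.cast_succ, ← hF.comp, coeff_one_subst (hF.constantCoeff 1), ih, hF.one, hf.coeff_one,
      one_mul]

theorem IsTangentToId.iter [CharZero K] (hf : IsTangentToId f) (s : K) :
    IsTangentToId (iter f s) where
  constantCoeff := hf.isIteration_iter.constantCoeff s
  coeff_one := by
    rw [Umbral.iter, coeff_atParam, hf.isFractionalIteration.coeff_one hf, Polynomial.eval_one]

theorem coeff_itlog (n : ℕ) :
    coeff n (itlog f) = (Polynomial.derivative (coeff n (fractionalIteration f))).eval 0 :=
  PowerSeries.coeff_mk _ _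

theorem IsTangentToId.X_sq_dvd_itlog [CharZero K] (hf : IsTangentToId f) : X ^ 2 ∣ itlog f := by
  have hF := hf.isFractionalIteration
  rw [PowerSeries.X_pow_dvd_iff]
  intro m hm
  rw [coeff_itlog]
  interval_cases m
  · rw [PowerSeries.coeff_zero_eq_constantCoeff_apply, hF.constantCoeff_eq_zero]
    simp
  · rw [hF.coeff_one hf]
    simp

theorem IsTangentToId.raisesOrder_mulDeriv_itlog [CharZero K] (hf : IsTangentToId f) :
    RaisesOrder (mulDeriv (itlog f)) 1 :=
  raisesOrder_mulDeriv hf.X_sq_dvd_itlog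

theorem coeff_subst_eq_eval [CharZero K] {F : PowerSeries K[X]} (hF : IsFractionalIteration f F)
    (h : K⟦X⟧) (n : ℕ) (s : K) :
    coeff n (subst (atParam F s) h) =
      (coeff n (subst F (PowerSeries.map Polynomial.C h))).eval s := by
  rw [← coeff_atParam, atParam_subst hF.constantCoeff_eq_zero, atParam_map_C]

theorem IsTangentToId.derivative_coeff_subst [CharZero K] (hf : IsTangentToId f) (h : K⟦X⟧)
    (n : ℕ) :
    Polynomial.derivative
        (coeff n (subst (fractionalIteration f) (PowerSeries.map Polynomial.C h))) =
      coeff n (subst (fractionalIteration f)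
        (PowerSeries.map Polynomial.C (mulDeriv (itlog f) h))) := by
  have hF := hf.isFractionalIteration
  set F := fractionalIteration f
  have hF₀ : atParam F 0 = X := IsIteration.zero hF hf.coeff_one_ne_zero
  refine Polynomial.funext fun s => ?_
  have hT := isPointDerivation_polynomial (0 : K)
  have hsubst := hT.coeff_subst (f := itlog f) hF.constantCoeff
    (fun n => ⟨coeff n F, fun s => coeff_atParam F s n, coeff_itlog n⟩) h
  rw [hF₀, PowerSeries.X_subst, ← mulDeriv_apply] at hsubst
  -- `F_(r+s) = F_r ∘ F_s` is linear in the coefficients of `F_r`, so only these are differentiated.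
  obtain ⟨P, hP, hP'⟩ := hT.sum (Finset.range (n + 1)) fun k _ =>
    hT.const_mul (coeff n (atParam F s ^ k)) (hsubst k)
  have hcomp : Polynomial.taylor s (coeff n (subst F (PowerSeries.map Polynomial.C h))) = P := by
    refine Polynomial.funext fun r => ?_
    rw [← hP r, Polynomial.taylor_eval, ← coeff_subst_eq_eval hF,
      ← IsIteration.subst_subst_apply hF, coeff_subst_eq_sum (hF.constantCoeff s) _ n.lt_succ_self]
    simp only [mul_comm]
  rw [← coeff_subst_eq_eval hF, coeff_subst_eq_sum (hF.constantCoeff s) _ n.lt_succ_self]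
  simp only [mul_comm (coeff _ (mulDeriv _ _))]
  rw [hP', ← hcomp, Polynomial.taylor_apply, Polynomial.derivative_comp]
  simp

theorem IsTangentToId.coeff_subst_iter [CharZero K] (hf : IsTangentToId f) (s : K) (h : K⟦X⟧)
    (n : ℕ) :
    coeff n (subst (Umbral.iter f s) h) = ∑ k ∈ Finset.range (n + 1),
      (k.factorial : K)⁻¹ * coeff n ((mulDeriv (itlog f) ^ k) h) * s ^ k := by
  have hF := hf.isFractionalIteration
  set P : K⟦X⟧ → K[X] := fun h =>
    coeff n (subst (fractionalIteration f) (PowerSeries.map Polynomial.C h)) with hP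
  have hiter : ∀ k h, Polynomial.derivative^[k] (P h) = P ((mulDeriv (itlog f) ^ k) h) := by
    intro k
    induction k with
    | zero => intro h; rfl
    | succ k ih =>
      intro h
      rw [Function.iterate_succ_apply, hP, hf.derivative_coeff_subst, ← hP, ih, pow_succ,
        Module.End.mul_apply]
  have hcoeff : ∀ k, (P h).coeff k =
      (k.factorial : K)⁻¹ * coeff n ((mulDeriv (itlog f) ^ k) h) := by
    intro k
    have := congrArg (Polynomial.eval 0) (hiter k h)
    rw [hP, ← coeff_subst_eq_eval hF, IsIteration.zero hF hf.coeff_one_ne_zero,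
      PowerSeries.X_subst, ← Polynomial.coeff_zero_eq_eval_zero,
      Polynomial.coeff_iterate_derivative, zero_add, Nat.descFactorial_self, nsmul_eq_mul] at this
    rw [← this, inv_mul_cancel_left₀ (Nat.cast_ne_zero.2 k.factorial_ne_zero)]
  have hdeg : (P h).natDegree < n + 1 := by
    rw [Nat.lt_succ_iff, Polynomial.natDegree_le_iff_coeff_eq_zero]
    intro k hk
    rw [hcoeff, hf.raisesOrder_mulDeriv_itlog.coeff_pow_apply_eq_zero _ hk, mul_zero]
  rw [Umbral.iter, coeff_subst_eq_eval hF, Polynomial.eval_eq_sum_range' hdeg]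
  simp only [hcoeff]

end Iteration

section Pairing

variable {R : Type*} [CommRing R]

/-- The pairing `⟨p, h⟩ = ∑ k, k! p_k h_k = (h(D) p)(0)` of polynomials with power series. -/
def pair : R[X] →ₗ[R] R⟦X⟧ →ₗ[R] R :=
  Polynomial.lsum fun k => LinearMap.toSpanSingleton R _ ((k.factorial : R) • coeff k)

theorem pair_eq_sum (p : R[X]) (h : R⟦X⟧) {N : ℕ} (hN : p.natDegree < N) :
    pair p h = ∑ k ∈ Finset.range N, p.coeff k * (k.factorial * coeff k h) := by
  rw [pair, Polynomial.lsum_apply, Polynomial.sum_over_range' p (by simp) N hN]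
  simp

theorem pair_X_pow (n : ℕ) (h : R⟦X⟧) :
    pair (Polynomial.X ^ n : R[X]) h = n.factorial * coeff n h := by
  rw [Polynomial.X_pow_eq_monomial, pair, Polynomial.lsum_apply,
    Polynomial.sum_monomial_index _ _ (by simp)]
  simp

theorem pair_apply_X_pow (p : R[X]) (n : ℕ) : pair p (X ^ n) = n.factorial * p.coeff n := by
  induction p using Polynomial.induction_on' with
  | add p q hp hq => rw [map_add, LinearMap.add_apply, hp, hq, Polynomial.coeff_add, mul_add]
  | monomial k a =>
    rw [← Polynomial.C_mul_X_pow_eq_monomial, ← Polynomial.smul_eq_C_mul, map_smul,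
      LinearMap.smul_apply, pair_X_pow, PowerSeries.coeff_X_pow, Polynomial.coeff_smul,
      Polynomial.coeff_X_pow]
    by_cases hk : k = n
    · simp [hk, mul_comm]
    · simp [hk, Ne.symm hk]

theorem pair_apply_one (p : R[X]) : pair p 1 = p.eval 0 := by
  rw [← pow_zero X, pair_apply_X_pow, Nat.factorial_zero, Nat.cast_one, one_mul,
    Polynomial.coeff_zero_eq_eval_zero]

theorem pair_eq_of_natDegree_le {p : R[X]} {h : R⟦X⟧} {d : ℕ} (hp : p.natDegree ≤ d)
    (hh : X ^ d ∣ h) : pair p h = p.coeff d * (d.factorial * coeff d h) := by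
  rw [pair_eq_sum p h (Nat.lt_succ_of_le hp), Finset.sum_range_succ, Finset.sum_eq_zero, zero_add]
  intro k hk
  rw [PowerSeries.X_pow_dvd_iff.1 hh k (Finset.mem_range.1 hk), mul_zero, mul_zero]

theorem pair_ext [IsDomain R] [CharZero R] {p q : R[X]} (H : ∀ h, pair p h = pair q h) :
    p = q := by
  ext n
  have := H (X ^ n)
  rw [pair_apply_X_pow, pair_apply_X_pow] at this
  exact mul_left_cancel₀ (Nat.cast_ne_zero.2 n.factorial_ne_zero) this

/-- `B` is the transpose of `V` with respect to `pair`. -/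
def IsTranspose (V : Module.End R R[X]) (B : R⟦X⟧ → R⟦X⟧) : Prop :=
  ∀ p h, pair (V p) h = pair p (B h)

namespace IsTranspose

variable {V W : Module.End R R[X]} {A B : R⟦X⟧ → R⟦X⟧}

theorem of_X_pow (H : ∀ (n : ℕ) (h : R⟦X⟧),
    pair (V (Polynomial.X ^ n)) h = n.factorial * coeff n (B h)) : IsTranspose V B := by
  intro p h
  induction p using Polynomial.induction_on' with
  | add p q hp hq => simp only [map_add, LinearMap.add_apply, hp, hq]
  | monomial n a =>
    rw [← Polynomial.C_mul_X_pow_eq_monomial, ← Polynomial.smul_eq_C_mul, map_smul, map_smul,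
      map_smul, LinearMap.smul_apply, LinearMap.smul_apply, H, pair_X_pow]

theorem eq [IsDomain R] [CharZero R] (hV : IsTranspose V B) (hW : IsTranspose W B) : V = W :=
  LinearMap.ext fun p => pair_ext fun h => by rw [hV, hW]

theorem one : IsTranspose (1 : Module.End R R[X]) id := fun _ _ => rfl

theorem mul (hV : IsTranspose V A) (hW : IsTranspose W B) : IsTranspose (V * W) (B ∘ A) :=
  fun p h => by rw [Module.End.mul_apply, hV, hW, Function.comp_apply]

theorem pow {A : Module.End R R⟦X⟧} (hV : IsTranspose V A) (k : ℕ) :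
    IsTranspose (V ^ k) ⇑(A ^ k) := by
  induction k with
  | zero => exact one
  | succ k ih => rw [pow_succ, pow_succ']; exact ih.mul hV

theorem pow_apply_eq_zero [IsDomain R] [CharZero R] {A : Module.End R R⟦X⟧}
    (hV : IsTranspose V A) (hA : RaisesOrder A 1) {p : R[X]} {k : ℕ} (hk : p.natDegree < k) :
    (V ^ k) p = 0 := by
  refine pair_ext fun h => ?_
  rw [hV.pow k, pair_eq_sum p _ p.natDegree.lt_succ_self, map_zero, LinearMap.zero_apply]
  refine Finset.sum_eq_zero fun j hj => ?_
  rw [hA.coeff_pow_apply_eq_zero _ (by rw [Finset.mem_range] at hj; omega), mul_zero, mul_zero]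

end IsTranspose

end Pairing

section SeriesOp

variable {K : Type*} [Field K]

theorem isTranspose_mulX : IsTranspose (mulX : Op K) (PowerSeries.derivative K) := by
  refine IsTranspose.of_X_pow fun n h => ?_
  rw [mulX, LinearMap.mulLeft_apply, ← pow_succ', pair_X_pow, PowerSeries.coeff_derivative,
    Nat.factorial_succ]
  push_cast
  ring

theorem constr_basisMonomials_X_pow (v : ℕ → K[X]) (n : ℕ) :
    (Polynomial.basisMonomials K).constr K v (Polynomial.X ^ n) = v n := by
  have := (Polynomial.basisMonomials K).constr_basis K v n
  simpa only [Polynomial.coe_basisMonomials, Polynomial.monomial_one_right_eq_X_pow] using this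

theorem seriesOp_X_pow (g : K⟦X⟧) (n : ℕ) :
    seriesOp g (Polynomial.X ^ n) = ∑ k ∈ Finset.range (n + 1),
      coeff k g • (D ^ k) (Polynomial.X ^ n : K[X]) :=
  constr_basisMonomials_X_pow _ n

theorem isTranspose_seriesOp (g : K⟦X⟧) : IsTranspose (seriesOp g) (g * ·) := by
  refine IsTranspose.of_X_pow fun n h => ?_
  rw [seriesOp_X_pow, PowerSeries.coeff_mul,
    Finset.Nat.sum_antidiagonal_eq_sum_range_succ (fun i j => coeff i g * coeff j h),
    Finset.mul_sum, map_sum, LinearMap.sum_apply]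
  refine Finset.sum_congr rfl fun k hk => ?_
  rw [map_smul, LinearMap.smul_apply, D, Module.End.pow_apply,
    Polynomial.iterate_derivative_X_pow_eq_smul, map_smul, LinearMap.smul_apply, pair_X_pow,
    smul_eq_mul, smul_eq_mul, ← Nat.factorial_mul_descFactorial (Finset.mem_range_succ_iff.1 hk)]
  push_cast
  ring

theorem pair_seriesOp (g h : K⟦X⟧) (p : K[X]) : pair (seriesOp g p) h = pair p (g * h) :=
  isTranspose_seriesOp g p h

theorem isTranspose_mulX_mul_seriesOp (g : K⟦X⟧) :
    IsTranspose (mulX * seriesOp g) (mulDeriv g) :=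
  isTranspose_mulX.mul (isTranspose_seriesOp g)

theorem eval_zero_seriesOp (g : K⟦X⟧) (p : K[X]) : (seriesOp g p).eval 0 = pair p g := by
  rw [← pair_apply_one, pair_seriesOp, mul_one]

theorem seriesOp_apply_X {g : K⟦X⟧} (hg : constantCoeff g = 0) :
    seriesOp g Polynomial.X = Polynomial.C (coeff 1 g) := by
  rw [← pow_one Polynomial.X, seriesOp_X_pow, Finset.sum_range_succ, Finset.sum_range_one,
    PowerSeries.coeff_zero_eq_constantCoeff_apply, hg]
  simp [D, Polynomial.smul_eq_C_mul]

theorem IsShiftInvariant.eval_apply {U : Op K} (hU : IsShiftInvariant U) (p : K[X]) (a : K) :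
    (U p).eval a = (U (Polynomial.taylor a p)).eval 0 := by
  have := LinearMap.congr_fun (hU a) p
  rw [Module.End.mul_apply, Module.End.mul_apply] at this
  rw [this, Polynomial.taylor_eval, zero_add]

variable [CharZero K]

theorem isTranspose_taylor (a : K) :
    IsTranspose (Polynomial.taylor a) (PowerSeries.rescale a (PowerSeries.exp K) * ·) := by
  refine IsTranspose.of_X_pow fun n h => ?_
  rw [Polynomial.taylor_apply, Polynomial.pow_comp, Polynomial.X_comp, add_pow, map_sum,
    LinearMap.sum_apply, mul_comm _ h, PowerSeries.coeff_mul,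
    Finset.Nat.sum_antidiagonal_eq_sum_range_succ
      (fun i j => coeff i h * coeff j (PowerSeries.rescale a (PowerSeries.exp K))), Finset.mul_sum]
  refine Finset.sum_congr rfl fun k hk => ?_
  have hmonomial : (Polynomial.X ^ k * Polynomial.C a ^ (n - k) * (n.choose k : K[X])) =
      ((n.choose k : K) * a ^ (n - k)) • Polynomial.X ^ k := by
    rw [Polynomial.smul_eq_C_mul]
    simp only [map_mul, map_pow, map_natCast]
    ring
  have hfact : ((n - k).factorial : K) ≠ 0 := Nat.cast_ne_zero.2 (Nat.factorial_ne_zero _)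
  rw [hmonomial, map_smul, LinearMap.smul_apply, pair_X_pow, PowerSeries.coeff_rescale,
    PowerSeries.coeff_exp,
    ← Nat.choose_mul_factorial_mul_factorial (Finset.mem_range_succ_iff.1 hk)]
  simp only [smul_eq_mul, map_div₀, map_one, map_natCast]
  push_cast
  field_simp

theorem isShiftInvariant_seriesOp (g : K⟦X⟧) : IsShiftInvariant (seriesOp g) := fun a =>
  IsTranspose.eq ((isTranspose_seriesOp g).mul (isTranspose_taylor a)) <| by
    convert (isTranspose_taylor a).mul (isTranspose_seriesOp g) using 1
    exact funext fun h => mul_left_comm _ _ _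

theorem eval_zero_apply_eq_pair_indicator (U : Op K) (p : K[X]) :
    (U p).eval 0 = pair p (indicator U) := by
  induction p using Polynomial.induction_on' with
  | add p q hp hq => simp only [map_add, Polynomial.eval_add, LinearMap.add_apply, hp, hq]
  | monomial n a =>
    rw [← Polynomial.C_mul_X_pow_eq_monomial, ← Polynomial.smul_eq_C_mul, map_smul, map_smul,
      Polynomial.eval_smul, LinearMap.smul_apply, pair_X_pow, indicator, PowerSeries.coeff_mk,
      mul_div_cancel₀ _ (Nat.cast_ne_zero.2 n.factorial_ne_zero)]

theorem seriesOp_indicator {Q : Op K} (hQ : IsShiftInvariant Q) : seriesOp (indicator Q) = Q :=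
  LinearMap.ext fun p => Polynomial.funext fun a => by
    rw [(isShiftInvariant_seriesOp _).eval_apply, hQ.eval_apply, eval_zero_seriesOp,
      eval_zero_apply_eq_pair_indicator]

end SeriesOp

section Umbral

variable {K : Type*} [Field K] {φ Q : Op K}

theorem constantCoeff_indicator (U : Op K) : constantCoeff (indicator U) = (U 1).eval 0 := by
  rw [← PowerSeries.coeff_zero_eq_constantCoeff_apply, indicator, PowerSeries.coeff_mk, pow_zero,
    Nat.factorial_zero, Nat.cast_one, div_one]

theorem coeff_one_indicator (U : Op K) : coeff 1 (indicator U) = (U Polynomial.X).eval 0 := by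
  rw [indicator, PowerSeries.coeff_mk, pow_one, Nat.factorial_one, Nat.cast_one, div_one]

theorem IsUmbralFor.constantCoeff_indicator (hφ : IsUmbralFor φ Q) :
    constantCoeff (indicator Q) = 0 := by
  have hQ := hφ.sheffer 0
  rw [pow_zero, hφ.zeroth, Nat.cast_zero, zero_smul] at hQ
  rw [Umbral.constantCoeff_indicator, hQ, Polynomial.eval_zero]

theorem IsUmbralFor.X_pow_dvd_indicator_pow (hφ : IsUmbralFor φ Q) (d : ℕ) :
    X ^ d ∣ indicator Q ^ d :=
  pow_dvd_pow_of_dvd (PowerSeries.X_dvd_iff.2 hφ.constantCoeff_indicator) d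

theorem IsDelta.apply_X (hQ : IsDelta Q) :
    Q Polynomial.X = Polynomial.C (coeff 1 (indicator Q)) := by
  obtain ⟨-, c, -, hc⟩ := hQ
  rw [coeff_one_indicator, hc, Polynomial.eval_C]

theorem IsDelta.coeff_one_indicator_ne_zero (hQ : IsDelta Q) : coeff 1 (indicator Q) ≠ 0 := by
  obtain ⟨-, c, hc₀, hc⟩ := hQ
  rwa [coeff_one_indicator, hc, Polynomial.eval_C]

variable [CharZero K]

theorem IsUmbralFor.pair_X_pow_subst (hφ : IsUmbralFor φ Q) (n : ℕ) (h : K⟦X⟧) :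
    pair (φ (Polynomial.X ^ n)) (subst (indicator Q) h) = n.factorial * coeff n h := by
  have hs := HasSubst.of_constantCoeff_zero' hφ.constantCoeff_indicator
  obtain ⟨q, hq⟩ := PowerSeries.X_dvd_iff.2
    (show constantCoeff (h - PowerSeries.C (constantCoeff h)) = 0 by simp)
  rw [sub_eq_iff_eq_add] at hq
  have hsubst : subst (indicator Q) h =
      indicator Q * subst (indicator Q) q + constantCoeff h • (1 : K⟦X⟧) := by
    conv_lhs => rw [hq]
    rw [PowerSeries.subst_add hs, PowerSeries.subst_mul hs, PowerSeries.subst_X hs,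
      PowerSeries.subst_C, PowerSeries.smul_eq_C_mul, mul_one]
    rfl
  have hQ : pair (φ (Polynomial.X ^ n)) (indicator Q * subst (indicator Q) q) =
      n * pair (φ (Polynomial.X ^ (n - 1))) (subst (indicator Q) q) := by
    rw [← pair_seriesOp, seriesOp_indicator hφ.delta.1, hφ.sheffer, map_smul,
      LinearMap.smul_apply, smul_eq_mul]
  rw [hsubst, map_add, hQ, map_smul, pair_apply_one]
  cases n with
  | zero => simp [hφ.zeroth]
  | succ n =>
    have hcoeff : coeff (n + 1) h = coeff n q := by
      rw [hq, map_add, PowerSeries.coeff_succ_X_mul, PowerSeries.coeff_C, if_neg n.succ_ne_zero,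
        add_zero]
    rw [hφ.eval_zero _ n.succ_pos, Nat.add_sub_cancel, hφ.pair_X_pow_subst n q, hcoeff,
      Nat.factorial_succ, smul_zero, add_zero]
    push_cast
    ring

theorem IsUmbralFor.pair_subst (hφ : IsUmbralFor φ Q) (p : K[X]) (h : K⟦X⟧) :
    pair (φ p) (subst (indicator Q) h) = pair p h := by
  induction p using Polynomial.induction_on' with
  | add p q hp hq => simp only [map_add, LinearMap.add_apply, hp, hq]
  | monomial n a =>
    rw [← Polynomial.C_mul_X_pow_eq_monomial, ← Polynomial.smul_eq_C_mul, map_smul, map_smul,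
      map_smul, LinearMap.smul_apply, LinearMap.smul_apply, hφ.pair_X_pow_subst, pair_X_pow]

theorem IsUmbralFor.pair_indicator_pow (hφ : IsUmbralFor φ Q) (n d : ℕ) :
    pair (φ (Polynomial.X ^ n)) (indicator Q ^ d) = if n = d then (n.factorial : K) else 0 := by
  rw [← subst_X_pow hφ.constantCoeff_indicator, hφ.pair_X_pow_subst, PowerSeries.coeff_X_pow,
    mul_ite, mul_one, mul_zero]

theorem IsUmbralFor.natDegree_apply_X_pow_le (hφ : IsUmbralFor φ Q) (n : ℕ) :
    (φ (Polynomial.X ^ n)).natDegree ≤ n := by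
  by_contra! hlt
  have hpair := hφ.pair_indicator_pow n (φ (Polynomial.X ^ n)).natDegree
  rw [if_neg hlt.ne, pair_eq_of_natDegree_le le_rfl (hφ.X_pow_dvd_indicator_pow _),
    coeff_self_pow hφ.constantCoeff_indicator] at hpair
  have hne : φ (Polynomial.X ^ n) ≠ 0 := fun h => by simp [h] at hlt
  exact mul_ne_zero (Polynomial.leadingCoeff_ne_zero.2 hne)
    (mul_ne_zero (Nat.cast_ne_zero.2 (Nat.factorial_ne_zero _))
      (pow_ne_zero _ hφ.delta.coeff_one_indicator_ne_zero)) hpair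

theorem IsUmbralFor.coeff_apply_X_pow_mul (hφ : IsUmbralFor φ Q) (n : ℕ) :
    (φ (Polynomial.X ^ n)).coeff n * coeff 1 (indicator Q) ^ n = 1 := by
  have hpair := hφ.pair_indicator_pow n n
  rw [if_pos rfl, pair_eq_of_natDegree_le (hφ.natDegree_apply_X_pow_le n)
    (hφ.X_pow_dvd_indicator_pow n), coeff_self_pow hφ.constantCoeff_indicator,
    mul_left_comm] at hpair
  exact (mul_eq_left₀ (Nat.cast_ne_zero.2 n.factorial_ne_zero)).1 hpair

theorem IsUmbralFor.isUnitaryOp_iff_coeff_one (hφ : IsUmbralFor φ Q) :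
    IsUnitaryOp φ ↔ coeff 1 (indicator Q) = 1 := by
  refine ⟨fun hu => ?_, fun h n => ?_⟩
  · have := hφ.coeff_apply_X_pow_mul 1
    rwa [hu 1, one_mul, pow_one] at this
  · simpa [h] using hφ.coeff_apply_X_pow_mul n

theorem IsUmbralFor.isUnitaryOp_iff (hφ : IsUmbralFor φ Q) :
    IsUnitaryOp φ ↔ IsUnitaryDelta Q := by
  rw [hφ.isUnitaryOp_iff_coeff_one, IsUnitaryDelta, and_iff_right hφ.delta.1, hφ.delta.apply_X,
    ← Polynomial.C_1, Polynomial.C_inj]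

theorem IsUmbralFor.isTangentToId_indicator (hφ : IsUmbralFor φ Q) (hu : IsUnitaryOp φ) :
    IsTangentToId (indicator Q) :=
  ⟨hφ.constantCoeff_indicator, hφ.isUnitaryOp_iff_coeff_one.1 hu⟩

theorem IsUmbralFor.isTranspose_subst (hφ : IsUmbralFor φ Q) {F : K → K⟦X⟧}
    (hF : IsIteration (indicator Q) F) : IsTranspose φ (subst (F (-1))) := fun p h => by
  have hinv := hF.subst_neg_subst hφ.delta.coeff_one_indicator_ne_zero (-1) h
  rw [neg_neg, hF.one] at hinv
  rw [← hφ.pair_subst p, hinv]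

theorem indicator_seriesOp (g : K⟦X⟧) : indicator (seriesOp g) = g := by
  ext n
  rw [indicator, PowerSeries.coeff_mk, eval_zero_seriesOp, pair_X_pow,
    mul_div_cancel_left₀ _ (Nat.cast_ne_zero.2 n.factorial_ne_zero)]

theorem isDelta_seriesOp {f : K⟦X⟧} (hf : constantCoeff f = 0) (hf' : coeff 1 f ≠ 0) :
    IsDelta (seriesOp f) :=
  ⟨isShiftInvariant_seriesOp f, coeff 1 f, hf', seriesOp_apply_X hf⟩

theorem isUmbralFor_of_pair_subst {f : K⟦X⟧} (hφ : IsUnit φ) (hf : constantCoeff f = 0)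
    (hf' : coeff 1 f ≠ 0) (H : ∀ p h, pair (φ p) (subst f h) = pair p h) :
    IsUmbralFor φ (seriesOp f) where
  delta := isDelta_seriesOp hf hf'
  invertible := hφ
  sheffer n := pair_ext <| (subst_surjective hf hf'.isUnit).forall.2 fun h => by
    have hs := HasSubst.of_constantCoeff_zero' hf
    have hmul : f * subst f h = subst f (X * h) := by
      rw [PowerSeries.subst_mul hs, PowerSeries.subst_X hs]
    rw [pair_seriesOp, hmul, H, map_smul, LinearMap.smul_apply, H, pair_X_pow, pair_X_pow]
    cases n with
    | zero => simp
    | succ n =>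
      rw [PowerSeries.coeff_succ_X_mul, Nat.add_sub_cancel, Nat.factorial_succ, smul_eq_mul]
      push_cast
      ring
  zeroth := pair_ext <| (subst_surjective hf hf'.isUnit).forall.2 fun h => by
    rw [H, ← pow_zero Polynomial.X, pair_X_pow, pair_X_pow,
      PowerSeries.coeff_zero_eq_constantCoeff_apply,
      PowerSeries.coeff_zero_eq_constantCoeff_apply,
      constantCoeff_subst_of_constantCoeff_eq_zero hf]
  eval_zero n hn := by
    have := H (Polynomial.X ^ n) (X ^ 0)
    rwa [subst_X_pow hf, pow_zero, pow_zero, pair_apply_one, pair_apply_one,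
      Polynomial.eval_pow, Polynomial.eval_X, zero_pow hn.ne'] at this

end Umbral

section Exponential

variable {K : Type*} [Field K]

theorem neg_smul_pow {R A : Type*} [CommRing R] [Ring A] [Algebra R A] (s : R) (a : A) (k : ℕ) :
    (-(s • a)) ^ k = (-s) ^ k • a ^ k := by
  rw [← neg_smul, smul_pow]

theorem opExp_X_pow {V : Op K} {n : ℕ} (hV : ∀ k, n < k → (V ^ k) (Polynomial.X ^ n) = 0) :
    opExp V (Polynomial.X ^ n) = ∑ k ∈ Finset.range (n + 1),
      (k.factorial : K)⁻¹ • (V ^ k) (Polynomial.X ^ n : K[X]) := by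
  rw [opExp, constr_basisMonomials_X_pow]
  refine finsum_eq_sum_of_support_subset _ fun k hk => ?_
  rw [Finset.coe_range, Set.mem_Iio]
  by_contra hlt
  exact hk (by simp only [hV k (by omega), smul_zero])

variable [CharZero K]

theorem isLocallyNilpotent_mulX_mul_seriesOp {g : K⟦X⟧} (hg : X ^ 2 ∣ g) :
    IsLocallyNilpotent (mulX * seriesOp g) := fun p =>
  ⟨p.natDegree + 1, (isTranspose_mulX_mul_seriesOp g).pow_apply_eq_zero
    (raisesOrder_mulDeriv hg) p.natDegree.lt_succ_self⟩

theorem IsTangentToId.isTranspose_opExp {f : K⟦X⟧} (hf : IsTangentToId f) (s : K) :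
    IsTranspose (opExp (-(s • (mulX * seriesOp (itlog f))))) (subst (Umbral.iter f (-s))) := by
  have hU := isTranspose_mulX_mul_seriesOp (itlog f)
  have hpow := neg_smul_pow s (mulX * seriesOp (itlog f))
  refine IsTranspose.of_X_pow fun n h => ?_
  have hzero : ∀ k, n < k →
      ((-(s • (mulX * seriesOp (itlog f))) : Op K) ^ k) (Polynomial.X ^ n) = 0 := fun k hk => by
    rw [hpow, LinearMap.smul_apply,
      hU.pow_apply_eq_zero hf.raisesOrder_mulDeriv_itlog (by simpa using hk), smul_zero]
  rw [opExp_X_pow hzero, map_sum, LinearMap.sum_apply, hf.coeff_subst_iter, Finset.mul_sum]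
  refine Finset.sum_congr rfl fun k _ => ?_
  rw [hpow, LinearMap.smul_apply, map_smul, map_smul, LinearMap.smul_apply, LinearMap.smul_apply,
    hU.pow k, pair_X_pow, smul_eq_mul, smul_eq_mul]
  ring

section FracPow

variable {φ Q : Op K}

theorem isTranspose_fracPow (hQ : IsTangentToId (indicator Q)) (s : K) :
    IsTranspose (fracPow Q s) (subst (iter (indicator Q) (-s))) :=
  hQ.isTranspose_opExp s

theorem fracPow_add (hQ : IsTangentToId (indicator Q)) (r s : K) :
    fracPow Q (r + s) = fracPow Q r * fracPow Q s := by
  refine (isTranspose_fracPow hQ (r + s)).eq ?_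
  convert (isTranspose_fracPow hQ r).mul (isTranspose_fracPow hQ s) using 1
  exact funext fun h => by
    rw [Function.comp_apply, hQ.isIteration_iter.subst_subst_apply, neg_add]

theorem fracPow_zero (hQ : IsTangentToId (indicator Q)) : fracPow Q 0 = 1 := by
  refine (isTranspose_fracPow hQ 0).eq ?_
  convert IsTranspose.one using 1
  exact funext fun h => by
    rw [neg_zero, hQ.isIteration_iter.zero hQ.coeff_one_ne_zero, PowerSeries.X_subst, id]

/-- The homomorphism `s ↦ φ^s` from the additive group of scalars to the operators. -/
def fracPowHom (hQ : IsTangentToId (indicator Q)) : Multiplicative K →* Op K where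
  toFun s := fracPow Q s.toAdd
  map_one' := fracPow_zero hQ
  map_mul' r s := fracPow_add hQ r.toAdd s.toAdd

theorem isUnit_fracPow (hQ : IsTangentToId (indicator Q)) (s : K) : IsUnit (fracPow Q s) :=
  (Group.isUnit (Multiplicative.ofAdd s)).map (fracPowHom hQ)

theorem fracPow_intCast (hQ : IsTangentToId (indicator Q)) {u : (Op K)ˣ}
    (hu : (u : Op K) = fracPow Q 1) (n : ℤ) :
    fracPow Q n = ((u ^ n : (Op K)ˣ) : Op K) := by
  have hu' : u = (fracPowHom hQ).toHomUnits (Multiplicative.ofAdd 1) := Units.ext hu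
  rw [hu', ← map_zpow, ← ofAdd_zsmul, zsmul_one]
  rfl

theorem IsUmbralFor.eq_fracPow_one (hφ : IsUmbralFor φ Q)
    (hQ : IsTangentToId (indicator Q)) : φ = fracPow Q 1 :=
  (hφ.isTranspose_subst hQ.isIteration_iter).eq (isTranspose_fracPow hQ 1)

theorem isUmbralFor_fracPow (hQ : IsTangentToId (indicator Q)) (s : K) :
    IsUmbralFor (fracPow Q s) (seriesOp (iter (indicator Q) s)) :=
  isUmbralFor_of_pair_subst (isUnit_fracPow hQ s) (hQ.iter s).constantCoeff
    (hQ.iter s).coeff_one_ne_zero fun p h => by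
      rw [isTranspose_fracPow hQ s, hQ.isIteration_iter.subst_neg_subst hQ.coeff_one_ne_zero]

theorem isUnitaryOp_fracPow (hQ : IsTangentToId (indicator Q)) (s : K) :
    IsUnitaryOp (fracPow Q s) := by
  rw [(isUmbralFor_fracPow hQ s).isUnitaryOp_iff_coeff_one, indicator_seriesOp]
  exact (hQ.iter s).coeff_one

end FracPow

end Exponential

section RCLike

variable {𝕜 : Type*} [RCLike 𝕜]

theorem exp_smul_apply_of_hasDerivAt {E : Type*} [NormedAddCommGroup E] [NormedSpace 𝕜 E]
    [CompleteSpace E] (M : E →L[𝕜] E) {v : 𝕜 → E} (hv : ∀ u, HasDerivAt v (M (v u)) u) (s : 𝕜) :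
    NormedSpace.exp (s • M) (v 0) = v s := by
  have hderiv : ∀ u, HasDerivAt (fun u => NormedSpace.exp ((s - u) • M) (v u)) 0 u := fun u => by
    convert ((hasDerivAt_exp_smul_const M (s - u)).comp_const_sub s u).clm_apply (hv u) using 1
    simp
  have hconst := is_const_of_deriv_eq_zero (fun u => (hderiv u).differentiableAt)
    (fun u => (hderiv u).deriv) 0 s
  simpa using hconst

theorem hasSum_pow_of_hasDerivAt {E : Type*} [NormedAddCommGroup E] [NormedSpace 𝕜 E]
    [CompleteSpace E] (M : E →L[𝕜] E) {v : 𝕜 → E} (hv : ∀ u, HasDerivAt v (M (v u)) u) (s : 𝕜) :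
    HasSum (fun k : ℕ => (k.factorial : 𝕜)⁻¹ • (s ^ k • (M ^ k) (v 0))) (v s) := by
  have hexp := (NormedSpace.exp_series_hasSum_exp' (𝕂 := 𝕜) (s • M)).mapL
    (ContinuousLinearMap.apply 𝕜 E (v 0))
  rw [ContinuousLinearMap.apply_apply, exp_smul_apply_of_hasDerivAt M hv] at hexp
  simpa only [smul_pow, map_smul, ContinuousLinearMap.apply_apply] using hexp

variable {f g : 𝕜⟦X⟧} {F : 𝕜 → 𝕜⟦X⟧}

theorem IsIteration.constantCoeff_eq_zero_of_isItlog (hF : IsIteration f F) (hg : IsItlog F g) :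
    PowerSeries.constantCoeff g = 0 := by
  have hg₀ := hg 0
  simp only [PowerSeries.coeff_zero_eq_constantCoeff_apply, hF.constantCoeff] at hg₀
  exact hg₀.unique (hasDerivAt_const _ _)

theorem IsIteration.hasDerivAt_coeff_subst (hF : IsIteration f F) (hf : coeff 1 f ≠ 0)
    (hg : IsItlog F g) (h : 𝕜⟦X⟧) (n : ℕ) (s : 𝕜) :
    HasDerivAt (fun s => coeff n (subst (F s) h)) (coeff n (mulDeriv g (subst (F s) h))) s := by
  have hzero := (isPointDerivation_hasDerivAt (0 : 𝕜)).coeff_subst hF.constantCoeff hg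
    (subst (F s) h) n
  rw [hF.zero hf, PowerSeries.X_subst, ← mulDeriv_apply, ← sub_self s] at hzero
  simpa only [hF.subst_subst_apply, add_sub_cancel] using hzero.comp_sub_const s s

theorem IsIteration.hasSum_coeff_subst (hF : IsIteration f F) (hf : coeff 1 f ≠ 0)
    (hg : IsItlog F g) (h : 𝕜⟦X⟧) (n : ℕ) (s : 𝕜) :
    HasSum (fun k : ℕ => (k.factorial : 𝕜)⁻¹ * (s ^ k * coeff n ((mulDeriv g ^ k) h)))
      (coeff n (subst (F s) h)) := by
  have hraise : RaisesOrder (mulDeriv g) 0 := raisesOrder_mulDeriv <| by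
    simpa using PowerSeries.X_dvd_iff.2 (hF.constantCoeff_eq_zero_of_isItlog hg)
  obtain ⟨M₀, hM₀⟩ := hraise.exists_truncation (n + 1)
  let M : (Fin (n + 1) → 𝕜) →L[𝕜] (Fin (n + 1) → 𝕜) := LinearMap.toContinuousLinearMap M₀
  have hM : ∀ h, M (coeffs 𝕜 (n + 1) h) = coeffs 𝕜 (n + 1) (mulDeriv g h) := hM₀
  have hpow : ∀ k h, (M ^ k) (coeffs 𝕜 (n + 1) h) = coeffs 𝕜 (n + 1) ((mulDeriv g ^ k) h) := by
    intro k
    induction k with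
    | zero => exact fun _ => rfl
    | succ k ih =>
      intro h
      rw [pow_succ, pow_succ, Module.End.mul_apply, mul_apply_eq_comp, hM, ih]
  have hode : ∀ u, HasDerivAt (fun u => coeffs 𝕜 (n + 1) (subst (F u) h))
      (M (coeffs 𝕜 (n + 1) (subst (F u) h))) u := fun u => by
    rw [hM, hasDerivAt_pi]
    exact fun i => hF.hasDerivAt_coeff_subst hf hg h i u
  have hsum := Pi.hasSum.1 (hasSum_pow_of_hasDerivAt M hode s) (Fin.last n)
  simpa only [hF.zero hf, PowerSeries.X_subst, hpow, Pi.smul_apply, smul_eq_mul, coeffs_apply,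
    Fin.val_last] using hsum

theorem IsTranspose.hasOpExp {U V : Op 𝕜} {A : Module.End 𝕜 𝕜⟦X⟧} {B : 𝕜⟦X⟧ → 𝕜⟦X⟧}
    (hU : IsTranspose U A) (hV : IsTranspose V B)
    (H : ∀ h n, HasSum (fun k : ℕ => (k.factorial : 𝕜)⁻¹ * coeff n ((A ^ k) h)) (coeff n (B h))) :
    HasOpExp U V := by
  intro p n
  have hn : (n.factorial : 𝕜) ≠ 0 := Nat.cast_ne_zero.2 n.factorial_ne_zero
  have hcoeff : ∀ q : 𝕜[X], q.coeff n = (n.factorial : 𝕜)⁻¹ * pair q (X ^ n) := fun q => by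
    rw [pair_apply_X_pow, inv_mul_cancel_left₀ hn]
  have hpair : HasSum (fun k : ℕ => (k.factorial : 𝕜)⁻¹ * pair p ((A ^ k) (X ^ n)))
      (pair p (B (X ^ n))) := by
    simp only [pair_eq_sum p _ p.natDegree.lt_succ_self, Finset.mul_sum]
    refine hasSum_sum fun i _ => ?_
    simpa only [mul_left_comm (_ : 𝕜)⁻¹] using
      ((H (X ^ n) i).mul_left (i.factorial : 𝕜)).mul_left (p.coeff i)
  simp only [hcoeff, map_smul, LinearMap.smul_apply, smul_eq_mul, hU.pow _ p, hV p]
  exact hpair.mul_left _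

theorem IsUmbralFor.hasOpExp {φ Q : Op 𝕜} (hφ : IsUmbralFor φ Q)
    (hF : IsIteration (indicator Q) F) (hg : IsItlog F g) :
    HasOpExp (-(mulX * seriesOp g)) φ := by
  have hU : IsTranspose (-(mulX * seriesOp g)) (-mulDeriv g) := fun p h => by
    rw [LinearMap.neg_apply, map_neg, LinearMap.neg_apply, isTranspose_mulX_mul_seriesOp,
      LinearMap.neg_apply, map_neg]
  refine hU.hasOpExp (hφ.isTranspose_subst hF) fun h n => ?_
  have hpow : ∀ k, coeff n (((-mulDeriv g) ^ k) h) = (-1) ^ k * coeff n ((mulDeriv g ^ k) h) :=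
    fun k => by
      have := neg_smul_pow (1 : 𝕜) (mulDeriv g) k
      rw [one_smul] at this
      rw [this, LinearMap.smul_apply, map_smul, smul_eq_mul]
  simpa only [hpow] using
    hF.hasSum_coeff_subst hφ.delta.coeff_one_indicator_ne_zero hg h n (-1)

end RCLike

end

end Umbral

theorem mainTheorem2 :
    (∀ (K : Type*) [Field K] [CharZero K] (Q φ : Umbral.Op K), Umbral.IsUmbralFor φ Q →
      Umbral.seriesOp (Umbral.indicator Q) = Q ∧
      (Umbral.IsUnitaryOp φ ↔ Umbral.IsUnitaryDelta Q) ∧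
      (Umbral.IsUnitaryOp φ →
        (∃! F, Umbral.IsFractionalIteration (Umbral.indicator Q) F) ∧
        Umbral.IsLocallyNilpotent (Umbral.mulX * Umbral.star Q) ∧
        φ = Umbral.opExp (-(Umbral.mulX * Umbral.star Q)) ∧
        (∀ r s : K, Umbral.fracPow Q (r + s) = Umbral.fracPow Q r * Umbral.fracPow Q s) ∧
        (∀ n : ℤ, ∀ u : (Umbral.Op K)ˣ, (u : Umbral.Op K) = φ →
          Umbral.fracPow Q (n : K) = ((u ^ n : (Umbral.Op K)ˣ) : Umbral.Op K)) ∧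
        (∀ s : K, Umbral.IsUnitaryOp (Umbral.fracPow Q s) ∧
          Umbral.IsUmbralFor (Umbral.fracPow Q s)
            (Umbral.seriesOp (Umbral.iter (Umbral.indicator Q) s))))) ∧
    (∀ (𝕜 : Type*) [RCLike 𝕜] (Q φ : Umbral.Op 𝕜), Umbral.IsUmbralFor φ Q →
      ∀ (F : 𝕜 → PowerSeries 𝕜) (g : PowerSeries 𝕜),
        Umbral.IsIteration (Umbral.indicator Q) F → Umbral.IsItlog F g →
        Umbral.HasOpExp (-(Umbral.mulX * Umbral.seriesOp g)) φ) := by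
  refine ⟨fun K _ _ Q φ hφ => ⟨Umbral.seriesOp_indicator hφ.delta.1, hφ.isUnitaryOp_iff,
    fun hu => ?_⟩, fun 𝕜 _ Q φ hφ F g hF hg => hφ.hasOpExp hF hg⟩
  have hQ : Umbral.IsTangentToId (Umbral.indicator Q) := hφ.isTangentToId_indicator hu
  have hφ_eq : φ = Umbral.fracPow Q 1 := hφ.eq_fracPow_one hQ
  exact ⟨hQ.existsUnique_isFractionalIteration,
    Umbral.isLocallyNilpotent_mulX_mul_seriesOp hQ.X_sq_dvd_itlog,
    by rwa [Umbral.fracPow, one_smul] at hφ_eq,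
    Umbral.fracPow_add hQ,
    fun n u huφ => Umbral.fracPow_intCast hQ (huφ.trans hφ_eq) n,
    fun s => ⟨Umbral.isUnitaryOp_fracPow hQ s, Umbral.isUmbralFor_fracPow hQ s⟩⟩
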